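/- Let $M$ be a smooth, connected, compact (finite-dimensional, Hausdorff) manifold, equipped with a finite non-zero Borel measure $\mathrm{d}m$ (for instance a Riemannian volume), and write $|M|=\int_M\mathrm{d}m$. Let $U\in L^\infty(M\times M)$ be real-valued and symmetric, $U(m,m')=U(m',m)$ for a.e. $(m,m')$, and assume that $\int_M U(m,m')\,\mathrm{d}m'$ is independent of $m$ (up to a null set). For $\beta>0$ and $\nu\in L^2(M)=L^2(M;\mathbb{R})$ put $$H_\nu(m)=\int_M U(m,m')\nu(m')\,\mathrm{d}m',\qquad \Phi(\beta,\nu)=\nu-\frac{\mathrm{e}^{-\beta H_\nu}}{\int_M \mathrm{e}^{-\beta H_\nu}\,\mathrm{d}m},$$ and define $K:L^2(M)\to L^2(M)$ by $$(K\mu)(m)=-|M|^{-1}\int_M\widetilde U(m,m')\mu(m')\,\mathrm{d}m',\qquad \widetilde U(m,m')=U(m,m')-|M|^{-1}\int_M U(m,m'')\,\mathrm{d}m''.$$ Suppose that there is $\beta_\star>0$ for which the set of solutions $\mu\in L^2(M)$ of the linear equation $\mu=\beta_\star K\mu$ is one-dimensional, spanned by some $\mu_\star\in L^2(M)\setminus\{0\}$.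 Then there exist $\epsilon>0$ and a continuous map $$(-\epsilon,\epsilon)\ni s\mapsto(\beta(s),\nu(s))\in(0,\infty)\times L^2(M)$$ such that $\beta(0)=\beta_\star$, $\nu(0)=|M|^{-1}$, $\Phi(\beta(s),\nu(s))=0$ for all $s\in(-\epsilon,\epsilon)$, and $\nu(s)$ is non-isotropic (not a.e. equal to a constant) for every $s\neq0$. Furthermore $$\nu(s)=|M|^{-1}+s(\mu_\star+\rho(s)),\qquad s\in(-\epsilon,\epsilon),$$ where $\rho:(-\epsilon,\epsilon)\to L^2(M)$ is continuous, $\rho(0)=0$, and $\rho(s)$ is orthogonal to $\mu_\star$ in $L^2(M)$ for all $s\in(-\epsilon,\epsilon)$. -/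

import Mathlib

open MeasureTheory
open scoped ENNReal ContDiff

noncomputable section

namespace MeanField

variable {M : Type*} [MeasurableSpace M]

/-- The total volume `|M|`. -/
def totalVolume (vol : Measure M) : ℝ := vol.real Set.univ

/-- The effective potential `H_ν(m) = ∫_M U(m, m') ν(m') dm'`. -/
def effectivePotential (vol : Measure M) (U : M → M → ℝ) (ν : M → ℝ) (m : M) : ℝ :=
  ∫ m', U m m' * ν m' ∂vol

/-- The partition function `Z_β(ν) = ∫_M exp (-β H_ν(m)) dm`. -/
def partitionFunction (vol : Measure M) (U : M → M → ℝ) (β : ℝ) (ν : M → ℝ) : ℝ :=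
  ∫ m, Real.exp (-β * effectivePotential vol U ν m) ∂vol

/-- The map `Φ(β, ν) = ν - exp (-β H_ν) / ∫_M exp (-β H_ν)`. -/
def Phi (vol : Measure M) (U : M → M → ℝ) (β : ℝ) (ν : M → ℝ) (m : M) : ℝ :=
  ν m - Real.exp (-β * effectivePotential vol U ν m) / partitionFunction vol U β ν

/-- `(β, ν) ∈ (0, ∞) × L²(M)` solves the self-consistency equation `Φ(β, ν) = 0`
(equality of functions almost everywhere, that is, in `L²(M)`). -/
def IsSolution (vol : Measure M) (U : M → M → ℝ) (β : ℝ) (ν : Lp ℝ 2 vol) : Prop :=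
  0 < β ∧ Phi vol U β ν =ᵐ[vol] 0

/-- The centred potential `Ũ(m, m') = U(m, m') - |M|⁻¹ ∫_M U(m, m'') dm''`. -/
def centredPotential (vol : Measure M) (U : M → M → ℝ) (m m' : M) : ℝ :=
  U m m' - (totalVolume vol)⁻¹ * ∫ m'', U m m'' ∂vol

/-- The operator `(K μ)(m) = -|M|⁻¹ ∫_M Ũ(m, m') μ(m') dm'`. -/
def K (vol : Measure M) (U : M → M → ℝ) (μ : M → ℝ) (m : M) : ℝ :=
  -(totalVolume vol)⁻¹ * ∫ m', centredPotential vol U m m' * μ m' ∂vol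

/-- The set of solutions `μ ∈ L²(M)` of the linearised equation `μ = β K μ`. -/
def linearisedSolutions (vol : Measure M) (U : M → M → ℝ) (β : ℝ) : Set (Lp ℝ 2 vol) :=
  {μ | μ =ᵐ[vol] fun m => β * K vol U μ m}

/-- A state is isotropic if it is (almost everywhere) constant. -/
def IsIsotropic (vol : Measure M) (ν : Lp ℝ 2 vol) : Prop :=
  ∃ c : ℝ, ν =ᵐ[vol] fun _ => c

/-- The isotropic state `|M|⁻¹`, as an element of `L²(M)`. -/
def isotropicState (vol : Measure M) [IsFiniteMeasure vol] : Lp ℝ 2 vol :=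
  Lp.const 2 vol (totalVolume vol)⁻¹

end MeanField

end

/-! This is bifurcation from a simple eigenvalue, obtained from the implicit function theorem. The
map `ν ↦ H_ν` sends `L²` into bounded functions; these form a Banach algebra, on which the
exponential is smooth.

Write `V = |M|` and `ν = V⁻¹ + s w`. Since `H` of a constant is a.e. constant, a common factor
cancels from the Boltzmann quotient, and `Φ(β, ν)` is exactly `s` times `w + β (V - sβ ∫q)⁻¹ (q -
V⁻¹ ∫q)`, where `q = (1 - exp(-sβ H_w)) / (sβ)`. This `q` extends smoothly to `s = 0` with value
`H_w`, where the bracket becomes `w - β K w`.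

Put `w = μ⋆ + ρ` with `ρ ⟂ μ⋆`. The unknowns `β` and `ρ` are packed into one vector `x` of `L²`, its
component along `μ⋆` encoding `β`. The derivative in `x` at the origin is `1 - β⋆ K + P`, with `P`
the projection onto `μ⋆`. As `K` is compact and self-adjoint with simple eigenvalue `1/β⋆`, this is
invertible by the Fredholm alternative. Finally `K 1 = 0` forces `μ⋆ ⟂ 1`, so `ν(s)` is not constant
for `s ≠ 0`.

The carrying lemmas are `isCompactOperator_toL2_comp`, `isUnit_one_sub_add_proj`,
`exists_bifurcation_branch` and `Phi_ae_eq_zero`. -/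

noncomputable section

namespace MeanField

open Filter Topology

/-! ### The Banach algebra of bounded measurable functions -/

/-- The subalgebra of measurable functions in the bounded real functions on `M`. -/
def boundedMeasurableSubalgebra (M : Type*) [MeasurableSpace M] :
    Subalgebra ℝ (lp (fun _ : M => ℝ) ∞) where
  carrier := {f | Measurable (f : M → ℝ)}
  mul_mem' {f g} hf hg := by
    simpa only [Set.mem_ofPred_eq, lp.infty_coeFn_mul] using Measurable.mul hf hg
  add_mem' {f g} hf hg := by
    simpa only [Set.mem_ofPred_eq, lp.coeFn_add] using Measurable.add hf hg
  algebraMap_mem' r := by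
    have : ((algebraMap ℝ (lp (fun _ : M => ℝ) ∞) r : lp (fun _ : M => ℝ) ∞) : M → ℝ) =
        fun _ => r := rfl
    simpa only [Set.mem_ofPred_eq, this] using measurable_const

/-- The Banach algebra of bounded measurable real functions on `M`, with the supremum norm. -/
def BoundedMeasurable (M : Type*) [MeasurableSpace M] : Type _ := boundedMeasurableSubalgebra M

variable {M : Type*} [MeasurableSpace M]

instance : NormedCommRing (BoundedMeasurable M) :=
  inferInstanceAs (NormedCommRing (boundedMeasurableSubalgebra M))

instance : NormedAlgebra ℝ (BoundedMeasurable M) :=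
  inferInstanceAs (NormedAlgebra ℝ (boundedMeasurableSubalgebra M))

/-- Uniform limits are pointwise limits, which preserve measurability, so the subalgebra is closed.
Genuine functions, rather than a.e. classes, make evaluation at a point a continuous functional. -/
instance : CompleteSpace (BoundedMeasurable M) := by
  have h : IsClosed (boundedMeasurableSubalgebra M : Set (lp (fun _ : M => ℝ) ∞)) := by
    refine IsSeqClosed.isClosed fun f g hf hfg => ?_
    refine measurable_of_tendsto_metrizable (f := fun n => (f n : M → ℝ)) hf ?_
    rw [tendsto_pi_nhds]
    exact fun m =>
      ((lp.lipschitzWith_one_eval (E := fun _ : M => ℝ) ∞ m).continuous.tendsto g).comp hfg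
  exact h.completeSpace_coe

instance : CoeFun (BoundedMeasurable M) fun _ => M → ℝ := ⟨fun f => (f.1 : M → ℝ)⟩

namespace BoundedMeasurable

theorem measurable (f : BoundedMeasurable M) : Measurable f := f.2

theorem abs_apply_le (f : BoundedMeasurable M) (m : M) : |f m| ≤ ‖f‖ :=
  lp.norm_apply_le_norm ENNReal.top_ne_zero f.1 m

/-- A bounded measurable function, as an element of the algebra. -/
def ofBound (f : M → ℝ) (hf : Measurable f) (C : ℝ) (hC : ∀ m, |f m| ≤ C) :
    BoundedMeasurable M :=
  ⟨⟨f, memℓp_infty ⟨C, by rintro _ ⟨m, rfl⟩; exact hC m⟩⟩, hf⟩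

@[simp]
theorem ofBound_apply (f : M → ℝ) (hf : Measurable f) (C : ℝ) (hC : ∀ m, |f m| ≤ C) (m : M) :
    ofBound f hf C hC m = f m := rfl

theorem norm_le {f : BoundedMeasurable M} {C : ℝ} (hC : 0 ≤ C) (h : ∀ m, |f m| ≤ C) : ‖f‖ ≤ C :=
  lp.norm_le_of_forall_le hC h

@[ext]
theorem ext {f g : BoundedMeasurable M} (h : ∀ m, f m = g m) : f = g :=
  Subtype.ext (lp.ext (funext h))

@[simp] theorem add_apply (f g : BoundedMeasurable M) (m : M) : (f + g) m = f m + g m := rfl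
@[simp] theorem sub_apply (f g : BoundedMeasurable M) (m : M) : (f - g) m = f m - g m := rfl
@[simp] theorem mul_apply (f g : BoundedMeasurable M) (m : M) : (f * g) m = f m * g m := rfl
@[simp] theorem smul_apply (c : ℝ) (f : BoundedMeasurable M) (m : M) : (c • f) m = c * f m := rfl
@[simp] theorem one_apply (m : M) : (1 : BoundedMeasurable M) m = 1 := rfl

/-- Evaluation at a point. -/
def evalCLM (m : M) : BoundedMeasurable M →L[ℝ] ℝ :=
  LinearMap.mkContinuous
    { toFun := fun f => f m
      map_add' := fun _ _ => rfl
      map_smul' := fun _ _ => rfl } 1 fun f => by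
        rw [one_mul]; exact abs_apply_le f m

@[simp] theorem evalCLM_apply (m : M) (f : BoundedMeasurable M) : evalCLM m f = f m := rfl

@[simp] theorem pow_apply (f : BoundedMeasurable M) (n : ℕ) (m : M) : (f ^ n) m = f m ^ n := by
  induction n with
  | zero => simp
  | succ n ih => simp [pow_succ, ih]

variable (vol : Measure M) [IsFiniteMeasure vol]

theorem memLp (f : BoundedMeasurable M) (p : ℝ≥0∞) : MemLp f p vol :=
  MemLp.of_bound f.measurable.aestronglyMeasurable ‖f‖ (ae_of_all _ f.abs_apply_le)

theorem integrable (f : BoundedMeasurable M) : Integrable f vol :=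
  (f.memLp vol 1).integrable le_rfl

/-- The inclusion of the bounded measurable functions into `L²`. -/
def toL2 : BoundedMeasurable M →L[ℝ] Lp ℝ 2 vol :=
  LinearMap.mkContinuous
    { toFun := fun f => (f.memLp vol 2).toLp f
      map_add' := fun _ _ => rfl
      map_smul' := fun _ _ => rfl } (vol.real Set.univ ^ ((2 : ℝ≥0∞).toReal)⁻¹) fun f => by
        refine Lp.norm_le_of_ae_bound (norm_nonneg f) ?_
        filter_upwards [(f.memLp vol 2).coeFn_toLp] with m hm
        exact (congrArg norm hm).trans_le (f.abs_apply_le m)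

theorem coeFn_toL2 (f : BoundedMeasurable M) : toL2 vol f =ᵐ[vol] f :=
  (f.memLp vol 2).coeFn_toLp

theorem inner_toL2 (f : BoundedMeasurable M) (g : Lp ℝ 2 vol) :
    inner ℝ (toL2 vol f) g = ∫ m, f m * g m ∂vol := by
  rw [L2.inner_def]
  refine integral_congr_ae ?_
  filter_upwards [coeFn_toL2 vol f] with m hm
  simp [hm, mul_comm]

/-- The integral, as a continuous linear functional. -/
def integralCLM : BoundedMeasurable M →L[ℝ] ℝ :=
  (innerSL ℝ (toL2 vol 1)).comp (toL2 vol)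

theorem integralCLM_apply (f : BoundedMeasurable M) : integralCLM vol f = ∫ m, f m ∂vol := by
  simp only [integralCLM, ContinuousLinearMap.comp_apply, innerSL_apply_apply, inner_toL2]
  refine integral_congr_ae ?_
  filter_upwards [coeFn_toL2 vol f] with m hm
  simp [hm]

end BoundedMeasurable

/-! ### Compactness -/

/-- Any bounded operator on `L²` which factors through the bounded measurable functions is
compact. -/
theorem isCompactOperator_toL2_comp (vol : Measure M) [IsFiniteMeasure vol]
    [TopologicalSpace.SeparableSpace (Lp ℝ 2 vol)]
    (B : Lp ℝ 2 vol →L[ℝ] BoundedMeasurable M) :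
    IsCompactOperator ((BoundedMeasurable.toL2 vol).comp B) := by
  rw [isCompactOperator_iff_exists_mem_nhds_image_subset_compact]
  refine ⟨Metric.closedBall 0 1, Metric.closedBall_mem_nhds 0 one_pos, _, ?_, subset_rfl⟩
  refine IsSeqCompact.isCompact fun y hy => ?_
  choose x hx hxy using hy
  let D := InnerProductSpace.toDual ℝ (Lp ℝ 2 vol)
  -- Sequential Banach–Alaoglu, available by separability, gives a weakly convergent subsequence.
  obtain ⟨ψ, hψ, k, hk, hlim⟩ := WeakDual.isSeqCompact_closedBall ℝ (Lp ℝ 2 vol) 0 1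
    (x := fun n => StrongDual.toWeakDual (D (x n))) (fun n => by
      have := hx n
      simpa using this)
  let z := D.symm (WeakDual.toStrongDual ψ)
  have hzψ : ∀ v, inner ℝ z v = ψ v := fun v => by
    simp [z, D]
  have hweak : ∀ v, Tendsto (fun n => inner ℝ (x (k n)) v) atTop (𝓝 (inner ℝ z v)) := fun v => by
    rw [hzψ]
    exact ((WeakDual.eval_continuous v).tendsto ψ).comp hlim
  have hz : z ∈ Metric.closedBall 0 1 := by
    have := hψ
    simpa [z] using this
  -- `x ↦ B x m` is a continuous functional, so weak convergence becomes pointwise convergence.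
  have hpt : ∀ m, Tendsto (fun n => B (x (k n)) m) atTop (𝓝 (B z m)) := fun m => by
    have h := hweak (D.symm ((BoundedMeasurable.evalCLM m).comp B))
    have e : ∀ v, inner ℝ v (D.symm ((BoundedMeasurable.evalCLM m).comp B)) = B v m := fun v => by
      rw [real_inner_comm]; simp [D]
    simpa only [e] using h
  refine ⟨_, ⟨z, hz, rfl⟩, k, hk, ?_⟩
  -- The factor `2` bounds the distance between two points of the unit ball. This uniform bound is
  -- the dominating function below.
  have hb : ∀ n m, |B (x (k n) - z) m| ≤ ‖B‖ * 2 := fun n m => by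
    refine ((B (x (k n) - z)).abs_apply_le m).trans ((B.le_opNorm _).trans ?_)
    gcongr
    have h1 := hx (k n)
    rw [mem_closedBall_zero_iff] at h1 hz
    linarith [norm_sub_le (x (k n)) z]
  have hint : Tendsto (fun n => ∫ m, (B (x (k n) - z) m) ^ 2 ∂vol) atTop
      (𝓝 (∫ _, (0 : ℝ) ∂vol)) := by
    refine tendsto_integral_of_dominated_convergence (fun _ => (‖B‖ * 2) ^ 2)
      (fun n => ((B (x (k n) - z)).measurable.pow_const 2).aestronglyMeasurable)
      (integrable_const _) (fun n => ae_of_all _ fun m => ?_) (ae_of_all _ fun m => ?_)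
    · rw [norm_pow]
      exact pow_le_pow_left₀ (norm_nonneg _) (hb n m) 2
    · have := ((hpt m).sub_const (B z m)).pow 2
      simpa [map_sub] using this
  rw [tendsto_iff_norm_sub_tendsto_zero]
  have hnorm : ∀ n, ‖y (k n) - (BoundedMeasurable.toL2 vol).comp B z‖ =
      √(∫ m, (B (x (k n) - z) m) ^ 2 ∂vol) := fun n => by
    rw [← hxy, ← map_sub, ContinuousLinearMap.comp_apply, ← Real.sqrt_sq (norm_nonneg _),
      ← real_inner_self_eq_norm_sq, BoundedMeasurable.inner_toL2]
    congr 1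
    refine integral_congr_ae ?_
    filter_upwards [BoundedMeasurable.coeFn_toL2 vol (B (x (k n) - z))] with m hm
    rw [hm, sq]
  simp only [Function.comp_def, hnorm]
  simpa using hint.sqrt

/-! ### The entire function `(exp x - 1) / x` -/

section ExpQuotient

open Nat

variable {A : Type*} [NormedCommRing A] [NormedAlgebra ℝ A]

/-- The entire function `x ↦ (exp x - 1) / x = ∑ xⁿ / (n + 1)!` on a Banach algebra. -/
def expQuotient (x : A) : A :=
  FormalMultilinearSeries.ofScalarsSum (𝕜 := ℝ) (E := A) (fun n => ((n + 1)! : ℝ)⁻¹) x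

@[simp]
theorem expQuotient_zero : expQuotient (0 : A) = 1 := by
  simp [expQuotient]

theorem expQuotient_radius :
    (FormalMultilinearSeries.ofScalars A (fun n => ((n + 1)! : ℝ)⁻¹)).radius = ⊤ := by
  refine FormalMultilinearSeries.ofScalars_radius_eq_top_of_tendsto A _
    (Eventually.of_forall fun n => by positivity) ?_
  have h := tendsto_one_div_add_atTop_nhds_zero_nat (𝕜 := ℝ)
  refine ((tendsto_add_atTop_iff_nat 1).2 h).congr fun n => ?_
  have : ((n + 1)! : ℝ) ≠ 0 := by positivity
  rw [Nat.succ_eq_add_one, Nat.factorial_succ (n + 1)]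
  simp only [norm_inv, RCLike.norm_natCast]
  push_cast
  field_simp

variable [CompleteSpace A]

theorem contDiff_expQuotient {n : WithTop ℕ∞} : ContDiff ℝ n (expQuotient : A → A) := by
  have h := (FormalMultilinearSeries.ofScalars A
    (fun n => ((n + 1)! : ℝ)⁻¹)).hasFPowerSeriesOnBall (by rw [expQuotient_radius]; simp)
  rw [expQuotient_radius] at h
  have h' : AnalyticOnNhd ℝ (expQuotient : A → A) Set.univ := fun x _ =>
    h.analyticAt_of_mem (by simp)
  exact contDiffOn_univ.1 (h'.contDiffOn uniqueDiffOn_univ)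

theorem hasSum_expQuotient (x : A) :
    HasSum (fun n : ℕ => ((n + 1)! : ℝ)⁻¹ • x ^ n) (expQuotient x) := by
  have h := (FormalMultilinearSeries.ofScalars A
    (fun n => ((n + 1)! : ℝ)⁻¹)).hasSum (x := x) (by rw [expQuotient_radius]; simp)
  simp only [FormalMultilinearSeries.ofScalars_apply_eq] at h
  exact h

theorem mul_expQuotient (x : ℝ) : x * expQuotient x = Real.exp x - 1 := by
  have h := (hasSum_expQuotient x).mul_left x
  have h2 : HasSum (fun n : ℕ => x ^ n / (n ! : ℝ)) (Real.exp x) := by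
    rw [Real.exp_eq_exp_ℝ]; exact NormedSpace.expSeries_div_hasSum_exp x
  have h3 := (hasSum_nat_add_iff' 1).2 h2
  have h4 : (fun n : ℕ => x * ((n + 1)! : ℝ)⁻¹ • x ^ n) =
      fun n => x ^ (n + 1) / ((n + 1)! : ℝ) := by
    ext n; simp only [smul_eq_mul]; ring
  rw [h4] at h
  simpa using h.unique h3

end ExpQuotient

/-- Evaluation is continuous, linear and multiplicative, so it passes through the power series term
by term. -/
theorem BoundedMeasurable.expQuotient_apply (f : BoundedMeasurable M) (m : M) :
    expQuotient f m = expQuotient (f m) := by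
  have h := (hasSum_expQuotient f).mapL (BoundedMeasurable.evalCLM m)
  refine h.unique ?_
  simpa using hasSum_expQuotient (f m)

/-! ### Abstract bifurcation from a simple eigenvalue -/

section Bifurcation

variable {X : Type*} [NormedAddCommGroup X] [InnerProductSpace ℝ X] [CompleteSpace X]

/-- If `k` is compact and `u` spans the kernel of `1 - k`, whose range is orthogonal to `u`, then
`1 - k + P` is invertible, where `P` is the orthogonal projection to the line spanned by `u`. -/
theorem isUnit_one_sub_add_proj {k P : X →L[ℝ] X} {u : X} (hu : u ≠ 0)
    (hP : ∀ x, P x = (inner ℝ u x / ‖u‖ ^ 2) • u)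
    (hcomp : IsCompactOperator (k - P)) (hker : ∀ x, x = k x → ∃ c : ℝ, x = c • u)
    (hrange : ∀ x, inner ℝ u (x - k x) = 0) :
    IsUnit (1 - k + P) := by
  have hu2 : ‖u‖ ^ 2 ≠ 0 := by positivity
  rcases hcomp.hasEigenvalue_or_mem_resolventSet one_ne_zero with h | h
  -- A fixed vector `x` of `k - P` has `x - k x = -P x`. Pairing with `u` gives `P x = 0`, so `x` is
  -- fixed by `k`, hence a multiple of `u` orthogonal to `u`.
  · exfalso
    obtain ⟨x, hx⟩ := h.exists_hasEigenvector
    have hx1 : k x - P x = x := by simpa using hx.apply_eq_smul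
    have h0 : inner ℝ u x = 0 := by
      have h2 := hrange x
      have h3 : x - k x = -P x := by
        rw [sub_eq_iff_eq_add, neg_add_eq_sub, hx1]
      rw [h3, hP, inner_neg_right, inner_smul_right, real_inner_self_eq_norm_sq] at h2
      field_simp at h2
      simpa using h2
    have hPx : P x = 0 := by simp [hP, h0]
    obtain ⟨c, rfl⟩ := hker x (by rw [hPx, sub_zero] at hx1; exact hx1.symm)
    rw [inner_smul_right, real_inner_self_eq_norm_sq] at h0
    have hc : c = 0 := by simpa [hu2] using h0
    exact hx.2 (by simp [hc])
  · have h1 := h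
    rw [spectrum.mem_resolventSet_iff] at h1
    convert h1 using 1
    simp; abel

variable {A : Type*} [NormedCommRing A] [NormedAlgebra ℝ A] [CompleteSpace A]

/-- The divided difference `(1 - exp (-t h)) / t` in a Banach algebra, with value `h` at `t = 0`. -/
def expDifference (t : ℝ) (h : A) : A := h * expQuotient (-(t • h))

/-- Bifurcation from a simple eigenvalue for the equation
`w + β Z⁻¹ (q - V⁻¹ ∫ q) = 0`, where `q` is the divided difference of `exp (- s β B w)` and `Z` is
the partition function, in an abstract Hilbert space `X` and a Banach algebra `A`. -/
theorem exists_bifurcation_branch (J : A →L[ℝ] X) (B : X →L[ℝ] A) (L : A →L[ℝ] ℝ) {V : ℝ}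
    (hV : V ≠ 0) (k : X →L[ℝ] X) (hk : ∀ x, k x = -V⁻¹ • (J (B x) - (V⁻¹ * L (B x)) • J 1))
    {b : ℝ} {u : X} (hu : u ≠ 0) (hku : u = b • k u)
    (hcomp : ∀ B' : X →L[ℝ] A, IsCompactOperator (J.comp B'))
    (hker : ∀ x, x = b • k x → ∃ c : ℝ, x = c • u)
    (hrange : ∀ x, inner ℝ u (x - b • k x) = 0) :
    ∃ (β : ℝ → ℝ) (ρ : ℝ → X), β 0 = b ∧ ρ 0 = 0 ∧ (∀ᶠ s in 𝓝 0, ContinuousAt β s) ∧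
      (∀ᶠ s in 𝓝 0, ContinuousAt ρ s) ∧ (∀ s, inner ℝ u (ρ s) = 0) ∧
      ∀ᶠ s in 𝓝 0, u + ρ s +
        (β s * (V - s * β s * L (expDifference (s * β s) (B (u + ρ s))))⁻¹) •
          (J (expDifference (s * β s) (B (u + ρ s))) -
            (V⁻¹ * L (expDifference (s * β s) (B (u + ρ s)))) • J 1) = 0 := by
  have hu2 : ‖u‖ ^ 2 ≠ 0 := by positivity
  let a : X →L[ℝ] ℝ := (‖u‖ ^ 2)⁻¹ • innerSL ℝ u
  have ha : ∀ x, a x = (‖u‖ ^ 2)⁻¹ * inner ℝ u x := fun x => rfl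
  let P : X →L[ℝ] X := a.smulRight u
  have hPx : ∀ x, P x = a x • u := fun x => rfl
  -- One unknown `x` carries both `β` and `ρ`. The sign and scale in `βf` are chosen so that the
  -- derivative along `u` is exactly `P`.
  let βf : X → ℝ := fun x => b * (1 - a x)
  let ρf : X → X := fun x => x - a x • u
  let q : ℝ × X → A := fun p => expDifference (p.1 * βf p.2) (B (u + ρf p.2))
  let F : ℝ × X → X := fun p => u + ρf p.2 +
    (βf p.2 * (V - p.1 * βf p.2 * L (q p))⁻¹) • (J (q p) - (V⁻¹ * L (q p)) • J 1)
  have hq0 : ∀ x, q (0, x) = B (u + ρf x) := fun x => by simp [q, expDifference]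
  -- At `s = 0` the equation is `w = β k w`; expanding with `u = b • k u` leaves a linear part and a
  -- quadratic remainder.
  have hF0 : ∀ x, F (0, x) = (1 - b • k + P) x + a x • (b • k x - a x • u) := fun x => by
    have h1 : F (0, x) = u + ρf x - βf x • k (u + ρf x) := by
      simp only [F, hq0, hk, smul_smul, zero_mul, sub_zero]
      module
    have h2 : βf x • k (u + ρf x) = (1 - a x) • (b • k u + b • k x - a x • (b • k u)) := by
      simp only [βf, ρf, map_add, map_sub, map_smul]
      module
    rw [h1, h2, ← hku]
    simp only [ρf, add_apply, sub_apply, hPx,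
      one_apply_eq_self, smul_apply]
    module
  have hβc : ContDiff ℝ 1 βf := by fun_prop
  have hρc : ContDiff ℝ 1 ρf := by fun_prop
  have hqc : ContDiff ℝ 1 q := by
    have h1 : ContDiff ℝ 1 (fun p : ℝ × X => B (u + ρf p.2)) := by fun_prop
    have h2 : ContDiff ℝ 1 (fun p : ℝ × X => -((p.1 * βf p.2) • B (u + ρf p.2))) := by fun_prop
    exact h1.mul (contDiff_expQuotient.comp h2)
  -- Only local smoothness is claimed: the partition function is known to be nonzero at `s = 0`,
  -- where it equals `V`.
  have hFc : ContDiffAt ℝ 1 F (0, 0) := by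
    have h1 : ContDiffAt ℝ 1 (fun p : ℝ × X => (V - p.1 * βf p.2 * L (q p))⁻¹) (0, 0) :=
      ContDiffAt.inv (by fun_prop) (by simpa using hV)
    fun_prop
  have hderiv : fderiv ℝ F (0, 0) ∘L .inr ℝ ℝ X = 1 - b • k + P := by
    have h1 : HasFDerivAt (fun x : X => F (0, x)) (fderiv ℝ F (0, 0) ∘L .inr ℝ ℝ X) 0 := by
      have h2 : HasFDerivAt F (fderiv ℝ F (0, 0)) ((0 : ℝ), (0 : X)) :=
        (hFc.differentiableAt one_ne_zero).hasFDerivAt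
      exact HasFDerivAt.comp (0 : X) h2 (hasFDerivAt_prodMk_right (0 : ℝ) (0 : X))
    have h2 : HasFDerivAt (fun x : X => F (0, x)) (1 - b • k + P) 0 := by
      have h3 : HasFDerivAt (fun x : X => a x • (b • k x - a x • u)) (0 : X →L[ℝ] X) 0 := by
        have := (a.hasFDerivAt (x := 0)).smul ((b • k - P).hasFDerivAt (x := 0))
        simp only [map_zero, zero_smul, ContinuousLinearMap.smulRight_zero, zero_add] at this
        exact this
      have h4 := ((1 - b • k + P).hasFDerivAt (x := (0 : X))).add h3
      rw [add_zero] at h4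
      exact h4.congr_of_eventuallyEq (Eventually.of_forall hF0)
    exact h1.unique h2
  have hunit : IsUnit (1 - b • k + P) := by
    refine isUnit_one_sub_add_proj hu (fun x => ?_) ?_ (by simpa using hker) (by simpa using hrange)
    · rw [hPx, ha]; congr 1; ring
    -- Since `u = b • k u` lies in the range of `J`, the projection `P` factors through `J` as `k`
    -- does, and so does `b • k - P`.
    · let f : X →L[ℝ] A := B - ((V⁻¹ • L).comp B).smulRight 1
      have hf : ∀ x, k x = J (-V⁻¹ • f x) := fun x => by simp [f, hk]
      let B' : X →L[ℝ] A := (-(b * V⁻¹)) • f - a.smulRight ((-(b * V⁻¹)) • f u)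
      have : b • k - P = J.comp B' := by
        ext1 x
        have e : P x = a x • b • k u := by rw [← hku, hPx]
        simp only [sub_apply, smul_apply, e, hf, B',
          ContinuousLinearMap.comp_apply, ContinuousLinearMap.smulRight_apply, map_sub, map_smul]
        module
      rw [this]
      exact hcomp B'
  have hinv : (fderiv ℝ F (0, 0) ∘L .inr ℝ ℝ X).IsInvertible := by
    rw [hderiv]
    obtain ⟨v, hv⟩ := hunit
    exact ⟨ContinuousLinearEquiv.unitsEquiv ℝ X v, hv⟩
  let g : ℝ → X := hFc.implicitFunction one_ne_zero hinv
  have hg0 : g 0 = 0 := hFc.implicitFunction_apply_self one_ne_zero hinv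
  have hgc : ∀ᶠ s in 𝓝 (0 : ℝ), ContinuousAt g s :=
    ((hFc.contDiffAt_implicitFunction one_ne_zero hinv).eventually (by simp)).mono
      fun s hs => hs.continuousAt
  have hgF : ∀ᶠ s in 𝓝 (0 : ℝ), F (s, g s) = 0 := by
    have h1 := hFc.eventually_apply_implicitFunction one_ne_zero hinv
    have h2 : F (0, 0) = 0 := by rw [hF0]; simp
    rw [h2] at h1
    exact h1
  refine ⟨fun s => βf (g s), fun s => ρf (g s), by simp [βf, hg0], by simp [ρf, hg0],
    hgc.mono fun s hs => hβc.continuous.continuousAt.comp hs,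
    hgc.mono fun s hs => hρc.continuous.continuousAt.comp hs, fun s => ?_, hgF⟩
  simp only [ρf, inner_sub_right, inner_smul_right, real_inner_self_eq_norm_sq, ha]
  field_simp
  simp

end Bifurcation

/-! ### The integral operators with a bounded kernel -/

section KernelOperator

variable (vol : Measure M) [IsFiniteMeasure vol] {U : M → M → ℝ}
  {C : ℝ}

/-- The section `U(m, ·)` of a bounded measurable kernel. -/
def kernelSection (hUm : Measurable fun p : M × M => U p.1 p.2)
    (hUC : ∀ m m', |U m m'| ≤ C) (m : M) : BoundedMeasurable M :=
  .ofBound (U m) (hUm.comp measurable_prodMk_left) C (hUC m)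

/-- Cauchy–Schwarz against the section `U(m, ·)`, whose `L²` norm is bounded uniformly in `m`. -/
theorem abs_effectivePotential_le (hUm : Measurable fun p : M × M => U p.1 p.2)
    (hC : 0 ≤ C) (hUC : ∀ m m', |U m m'| ≤ C) (ν : Lp ℝ 2 vol) (m : M) :
    |effectivePotential vol U ν m| ≤ ‖BoundedMeasurable.toL2 vol‖ * C * ‖ν‖ := by
  have h1 : effectivePotential vol U ν m =
      inner ℝ (BoundedMeasurable.toL2 vol (kernelSection hUm hUC m)) ν := by
    rw [BoundedMeasurable.inner_toL2]; rfl
  rw [h1]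
  refine (abs_real_inner_le_norm _ _).trans ?_
  gcongr
  refine (ContinuousLinearMap.le_opNorm _ _).trans ?_
  gcongr
  exact BoundedMeasurable.norm_le hC (hUC m)

theorem measurable_effectivePotential (hUm : Measurable fun p : M × M => U p.1 p.2)
    (ν : Lp ℝ 2 vol) :
    Measurable (effectivePotential vol U ν) := by
  have h : StronglyMeasurable fun p : M × M => U p.1 p.2 * ν p.2 :=
    hUm.stronglyMeasurable.mul ((Lp.stronglyMeasurable ν).comp_measurable measurable_snd)
  exact h.integral_prod_right'.measurable

theorem integrable_kernel_mul (hUm : Measurable fun p : M × M => U p.1 p.2)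
    (hUC : ∀ m m', |U m m'| ≤ C) (m : M) (ν : Lp ℝ 2 vol) :
    Integrable (fun m' => U m m' * ν m') vol :=
  ((Lp.memLp ν).integrable one_le_two).bdd_mul (c := C)
    (hUm.comp measurable_prodMk_left).aestronglyMeasurable (ae_of_all _ (hUC m))

variable (hUm : Measurable fun p : M × M => U p.1 p.2) (hC : 0 ≤ C)
  (hUC : ∀ m m', |U m m'| ≤ C)

/-- The effective potential of a bounded measurable kernel, as a bounded operator from `L²` to the
bounded measurable functions. -/
def potentialCLM : Lp ℝ 2 vol →L[ℝ] BoundedMeasurable M :=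
  LinearMap.mkContinuous
    { toFun := fun ν => .ofBound (effectivePotential vol U ν)
        (measurable_effectivePotential vol hUm ν) _ (abs_effectivePotential_le vol hUm hC hUC ν)
      map_add' := fun ν ν' => by
        ext m
        simp only [BoundedMeasurable.ofBound_apply, BoundedMeasurable.add_apply]
        rw [effectivePotential, effectivePotential, effectivePotential,
          ← integral_add (integrable_kernel_mul vol hUm hUC m ν)
            (integrable_kernel_mul vol hUm hUC m ν')]
        refine integral_congr_ae ?_
        filter_upwards [Lp.coeFn_add ν ν'] with m' h
        rw [h, Pi.add_apply, mul_add]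
      map_smul' := fun c ν => by
        ext m
        simp only [BoundedMeasurable.ofBound_apply, BoundedMeasurable.smul_apply,
          RingHom.id_apply]
        rw [effectivePotential, effectivePotential, ← integral_const_mul]
        refine integral_congr_ae ?_
        filter_upwards [Lp.coeFn_smul c ν] with m' h
        rw [h, Pi.smul_apply, smul_eq_mul]
        ring }
    (‖BoundedMeasurable.toL2 vol‖ * C) fun ν =>
      BoundedMeasurable.norm_le (by positivity) (abs_effectivePotential_le vol hUm hC hUC ν)

@[simp]
theorem potentialCLM_apply (ν : Lp ℝ 2 vol) (m : M) :
    potentialCLM vol hUm hC hUC ν m = effectivePotential vol U ν m := rfl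

/-- Writing the bilinear form as an integral over the product lets the a.e. symmetry of `U` be used
by swapping the variables. -/
theorem inner_toL2_potentialCLM (f g : Lp ℝ 2 vol) :
    inner ℝ (BoundedMeasurable.toL2 vol (potentialCLM vol hUm hC hUC f)) g =
      ∫ p : M × M, U p.1 p.2 * (g p.1 * f p.2) ∂(vol.prod vol) := by
  have hint : Integrable (fun p : M × M => U p.1 p.2 * (g p.1 * f p.2)) (vol.prod vol) :=
    (((Lp.memLp g).integrable one_le_two).mul_prod ((Lp.memLp f).integrable one_le_two)).bdd_mul
      (c := C) hUm.aestronglyMeasurable (ae_of_all _ fun p => hUC p.1 p.2)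
  rw [BoundedMeasurable.inner_toL2, integral_prod _ hint]
  refine integral_congr_ae (ae_of_all _ fun m => ?_)
  simp only [potentialCLM_apply, effectivePotential]
  rw [← integral_mul_const]
  refine integral_congr_ae (ae_of_all _ fun m' => ?_)
  simp only
  ring

theorem toL2_potentialCLM_symm
    (hsymm : ∀ᵐ p : M × M ∂(vol.prod vol), U p.1 p.2 = U p.2 p.1) (f g : Lp ℝ 2 vol) :
    inner ℝ (BoundedMeasurable.toL2 vol (potentialCLM vol hUm hC hUC f)) g =
      inner ℝ f (BoundedMeasurable.toL2 vol (potentialCLM vol hUm hC hUC g)) := by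
  rw [real_inner_comm _ f, inner_toL2_potentialCLM, inner_toL2_potentialCLM, ← integral_prod_swap]
  refine integral_congr_ae ?_
  filter_upwards [hsymm] with p hp
  simp only [Prod.fst_swap, Prod.snd_swap, hp]
  ring

theorem toL2_potentialCLM_one {c : ℝ} (hconst : ∀ᵐ m ∂vol, ∫ m', U m m' ∂vol = c) :
    BoundedMeasurable.toL2 vol (potentialCLM vol hUm hC hUC (BoundedMeasurable.toL2 vol 1)) =
      c • BoundedMeasurable.toL2 vol 1 := by
  refine Lp.ext ?_
  filter_upwards [hconst, Lp.coeFn_smul c (BoundedMeasurable.toL2 vol (1 : BoundedMeasurable M)),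
    BoundedMeasurable.coeFn_toL2 vol (1 : BoundedMeasurable M),
    BoundedMeasurable.coeFn_toL2 vol
      (potentialCLM vol hUm hC hUC (BoundedMeasurable.toL2 vol 1))] with m h1 h2 h3 h4
  rw [h4, h2, Pi.smul_apply, h3, potentialCLM_apply, BoundedMeasurable.one_apply, smul_eq_mul,
    mul_one, ← h1]
  refine integral_congr_ae ?_
  filter_upwards [BoundedMeasurable.coeFn_toL2 vol (1 : BoundedMeasurable M)] with m' h
  rw [h, BoundedMeasurable.one_apply, mul_one]

/-- The integral is the pairing with `1`; symmetry moves the operator onto `1`, an eigenvector with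
eigenvalue `c`. -/
theorem integralCLM_potentialCLM
    (hsymm : ∀ᵐ p : M × M ∂(vol.prod vol), U p.1 p.2 = U p.2 p.1)
    {c : ℝ} (hconst : ∀ᵐ m ∂vol, ∫ m', U m m' ∂vol = c) (x : Lp ℝ 2 vol) :
    BoundedMeasurable.integralCLM vol (potentialCLM vol hUm hC hUC x) =
      c * inner ℝ (BoundedMeasurable.toL2 vol 1) x := by
  rw [BoundedMeasurable.integralCLM, ContinuousLinearMap.comp_apply, innerSL_apply_apply,
    ← toL2_potentialCLM_symm vol hUm hC hUC hsymm, toL2_potentialCLM_one vol hUm hC hUC hconst,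
    inner_smul_left]
  rfl

/-- The operator `K` on `L²`. -/
def kernelCLM : Lp ℝ 2 vol →L[ℝ] Lp ℝ 2 vol :=
  -(totalVolume vol)⁻¹ • ((BoundedMeasurable.toL2 vol).comp (potentialCLM vol hUm hC hUC) -
    ((totalVolume vol)⁻¹ • (BoundedMeasurable.integralCLM vol).comp
      (potentialCLM vol hUm hC hUC)).smulRight (BoundedMeasurable.toL2 vol 1))

theorem kernelCLM_apply (x : Lp ℝ 2 vol) :
    kernelCLM vol hUm hC hUC x = -(totalVolume vol)⁻¹ •
      (BoundedMeasurable.toL2 vol (potentialCLM vol hUm hC hUC x) -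
        ((totalVolume vol)⁻¹ *
          BoundedMeasurable.integralCLM vol (potentialCLM vol hUm hC hUC x)) •
            BoundedMeasurable.toL2 vol 1) := rfl

/-- `K` subtracts the mean of `U(m, ·)` inside the integral, whereas `kernelCLM` subtracts the mean
of the potential. Both corrections equal `V⁻¹ c ∫ x`. -/
theorem coeFn_kernelCLM
    (hsymm : ∀ᵐ p : M × M ∂(vol.prod vol), U p.1 p.2 = U p.2 p.1)
    {c : ℝ} (hconst : ∀ᵐ m ∂vol, ∫ m', U m m' ∂vol = c) (x : Lp ℝ 2 vol) :
    kernelCLM vol hUm hC hUC x =ᵐ[vol] K vol U x := by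
  rw [kernelCLM_apply, integralCLM_potentialCLM vol hUm hC hUC hsymm hconst,
    BoundedMeasurable.inner_toL2, ← map_smul, ← map_sub, ← map_smul]
  refine (BoundedMeasurable.coeFn_toL2 vol _).trans ?_
  filter_upwards [hconst] with m hm
  have hx : Integrable x vol := (Lp.memLp x).integrable one_le_two
  simp only [BoundedMeasurable.smul_apply, BoundedMeasurable.sub_apply,
    BoundedMeasurable.one_apply, one_mul, mul_one, potentialCLM_apply, K, centredPotential, hm,
    sub_mul]
  rw [integral_sub (integrable_kernel_mul vol hUm hUC m x) (hx.const_mul _), integral_const_mul,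
    effectivePotential]
  ring

theorem kernelCLM_symm
    (hsymm : ∀ᵐ p : M × M ∂(vol.prod vol), U p.1 p.2 = U p.2 p.1)
    {c : ℝ} (hconst : ∀ᵐ m ∂vol, ∫ m', U m m' ∂vol = c) (x y : Lp ℝ 2 vol) :
    inner ℝ x (kernelCLM vol hUm hC hUC y) = inner ℝ (kernelCLM vol hUm hC hUC x) y := by
  simp only [kernelCLM_apply, integralCLM_potentialCLM vol hUm hC hUC hsymm hconst,
    inner_smul_left, inner_smul_right, inner_sub_left, inner_sub_right,
    toL2_potentialCLM_symm vol hUm hC hUC hsymm, conj_trivial,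
    real_inner_comm (BoundedMeasurable.toL2 vol 1) x]
  ring

theorem inner_toL2_one_self : inner ℝ (BoundedMeasurable.toL2 vol (1 : BoundedMeasurable M))
    (BoundedMeasurable.toL2 vol 1) = totalVolume vol := by
  have := BoundedMeasurable.integralCLM_apply vol (1 : BoundedMeasurable M)
  simpa [BoundedMeasurable.integralCLM, totalVolume] using this

theorem kernelCLM_one (hV : totalVolume vol ≠ 0)
    (hsymm : ∀ᵐ p : M × M ∂(vol.prod vol), U p.1 p.2 = U p.2 p.1)
    {c : ℝ} (hconst : ∀ᵐ m ∂vol, ∫ m', U m m' ∂vol = c) :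
    kernelCLM vol hUm hC hUC (BoundedMeasurable.toL2 vol 1) = 0 := by
  rw [kernelCLM_apply, integralCLM_potentialCLM vol hUm hC hUC hsymm hconst,
    toL2_potentialCLM_one vol hUm hC hUC hconst, inner_toL2_one_self]
  rw [mul_comm c, inv_mul_cancel_left₀ hV, sub_self, smul_zero]

theorem mem_linearisedSolutions_iff
    (hsymm : ∀ᵐ p : M × M ∂(vol.prod vol), U p.1 p.2 = U p.2 p.1)
    {c : ℝ} (hconst : ∀ᵐ m ∂vol, ∫ m', U m m' ∂vol = c) (b : ℝ) (x : Lp ℝ 2 vol) :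
    x ∈ linearisedSolutions vol U b ↔ x = b • kernelCLM vol hUm hC hUC x := by
  have h : (b • kernelCLM vol hUm hC hUC x : Lp ℝ 2 vol) =ᵐ[vol] fun m => b * K vol U x m := by
    filter_upwards [Lp.coeFn_smul b (kernelCLM vol hUm hC hUC x),
      coeFn_kernelCLM vol hUm hC hUC hsymm hconst x] with m h1 h2
    rw [h1, Pi.smul_apply, h2, smul_eq_mul]
  exact ⟨fun hx => Lp.ext (EventuallyEq.trans (show x =ᵐ[vol] _ from hx) h.symm),
    fun hx => (Lp.ext_iff.1 hx).trans h⟩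

end KernelOperator

/-! ### From the desingularised equation to the self-consistency equation -/

theorem isotropicState_eq (vol : Measure M) [IsFiniteMeasure vol] :
    isotropicState vol = (totalVolume vol)⁻¹ • BoundedMeasurable.toL2 vol 1 := by
  refine Lp.ext ?_
  filter_upwards [Lp.coeFn_const (p := 2) (μ := vol) ((totalVolume vol)⁻¹),
    Lp.coeFn_smul (totalVolume vol)⁻¹ (BoundedMeasurable.toL2 vol (1 : BoundedMeasurable M)),
    BoundedMeasurable.coeFn_toL2 vol (1 : BoundedMeasurable M)] with m h1 h2 h3
  rw [isotropicState, h1, h2, Pi.smul_apply, h3]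
  simp

theorem mul_expDifference_apply (t : ℝ) (h : BoundedMeasurable M) (m : M) :
    t * expDifference t h m = 1 - Real.exp (-(t * h m)) := by
  have h1 : expDifference t h m = h m * expQuotient (-(t * h m)) := by
    have : (-(t • h)) m = -(t * h m) := rfl
    rw [expDifference, BoundedMeasurable.mul_apply, BoundedMeasurable.expQuotient_apply, this]
  have h2 := mul_expQuotient (-(t * h m))
  rw [h1]
  linarith

theorem totalVolume_pos (vol : Measure M) [IsFiniteMeasure vol] [NeZero vol] :
    0 < totalVolume vol := by
  rw [totalVolume, measureReal_def]
  exact ENNReal.toReal_pos (by simpa using NeZero.ne vol) (measure_ne_top _ _)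

section Equation

variable (vol : Measure M) [IsFiniteMeasure vol] [NeZero vol] {U : M → M → ℝ} {C : ℝ}

/-- The desingularised equation for `w` implies the self-consistency equation for
`|M|⁻¹ + s w`. -/
theorem Phi_ae_eq_zero (hUm : Measurable fun p : M × M => U p.1 p.2) (hC : 0 ≤ C)
    (hUC : ∀ m m', |U m m'| ≤ C) {c : ℝ} (hconst : ∀ᵐ m ∂vol, ∫ m', U m m' ∂vol = c) {s β : ℝ}
    {w : Lp ℝ 2 vol} {q : BoundedMeasurable M}
    (hq : q = expDifference (s * β) (potentialCLM vol hUm hC hUC w))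
    (hw : w + (β * (totalVolume vol - s * β * BoundedMeasurable.integralCLM vol q)⁻¹) •
      (BoundedMeasurable.toL2 vol q - ((totalVolume vol)⁻¹ *
        BoundedMeasurable.integralCLM vol q) • BoundedMeasurable.toL2 vol 1) = 0) :
    Phi vol U β (isotropicState vol + s • w : Lp ℝ 2 vol) =ᵐ[vol] 0 := by
  set V := totalVolume vol with hVdef
  set B := potentialCLM vol hUm hC hUC with hB
  have hV : 0 < V := totalVolume_pos vol
  set Q := BoundedMeasurable.integralCLM vol q with hQ
  have hexp : ∀ m, Real.exp (-(s * β * B w m)) = 1 - s * β * q m := fun m => by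
    have := mul_expDifference_apply (s * β) (B w) m
    rw [hq]; linarith
  have hZ : ∫ m, (1 - s * β * q m) ∂vol = V - s * β * Q := by
    rw [integral_sub (integrable_const _) ((q.integrable vol).const_mul _), integral_const_mul,
      hQ, BoundedMeasurable.integralCLM_apply]
    simp [hVdef, totalVolume]
  -- The denominator is the integral of an exponential, hence positive without any smallness of `s`.
  have hZpos : 0 < V - s * β * Q := by
    rw [← hZ]
    simp only [← hexp]
    refine integral_exp_pos ?_
    simp only [hexp]
    exact (integrable_const _).sub ((q.integrable vol).const_mul _)
  have hpot : ∀ᵐ m ∂vol, effectivePotential vol U (isotropicState vol + s • w : Lp ℝ 2 vol) m =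
      V⁻¹ * c + s * B w m := by
    have h1 := toL2_potentialCLM_one vol hUm hC hUC hconst
    filter_upwards [Lp.ext_iff.1 h1,
      BoundedMeasurable.coeFn_toL2 vol (B (BoundedMeasurable.toL2 vol 1)),
      Lp.coeFn_smul c (BoundedMeasurable.toL2 vol (1 : BoundedMeasurable M)),
      BoundedMeasurable.coeFn_toL2 vol (1 : BoundedMeasurable M)] with m h2 h3 h4 h5
    have h6 : B (BoundedMeasurable.toL2 vol 1) m = c := by
      rw [← h3, h2, h4, Pi.smul_apply, h5]; simp
    rw [← potentialCLM_apply vol hUm hC hUC, isotropicState_eq, map_add, map_smul, map_smul,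
      BoundedMeasurable.add_apply, BoundedMeasurable.smul_apply, BoundedMeasurable.smul_apply,
      ← hB, h6]
  -- The isotropic part contributes only a constant factor, which also appears in the partition
  -- function and cancels.
  have hboltz : ∀ᵐ m ∂vol,
      Real.exp (-β * effectivePotential vol U (isotropicState vol + s • w : Lp ℝ 2 vol) m) =
        Real.exp (-β * (V⁻¹ * c)) * (1 - s * β * q m) := by
    filter_upwards [hpot] with m hm
    rw [hm, ← hexp, ← Real.exp_add]
    congr 1; ring
  have hpart : partitionFunction vol U β (isotropicState vol + s • w : Lp ℝ 2 vol) =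
      Real.exp (-β * (V⁻¹ * c)) * (V - s * β * Q) := by
    rw [partitionFunction, integral_congr_ae hboltz, integral_const_mul, hZ]
  rw [← map_smul, ← map_sub, ← map_smul] at hw
  -- The equation exhibits `w` as the class of a bounded function, so the identity can be checked
  -- pointwise.
  have hν : isotropicState vol + s • w = BoundedMeasurable.toL2 vol
      (V⁻¹ • 1 - s • (β * (V - s * β * Q)⁻¹) • (q - (V⁻¹ * Q) • 1)) := by
    rw [isotropicState_eq, eq_neg_of_add_eq_zero_left hw, smul_neg, ← sub_eq_add_neg, ← map_smul,
      ← map_smul, ← map_sub]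
  filter_upwards [hboltz, BoundedMeasurable.coeFn_toL2 vol
    (V⁻¹ • 1 - s • (β * (V - s * β * Q)⁻¹) • (q - (V⁻¹ * Q) • 1))] with m h1 h2
  rw [← hν] at h2
  rw [Phi, h1, h2, hpart, mul_div_mul_left _ _ (Real.exp_pos _).ne']
  simp only [BoundedMeasurable.sub_apply, BoundedMeasurable.smul_apply,
    BoundedMeasurable.one_apply, Pi.zero_apply]
  have := hZpos.ne'
  field_simp
  ring

/-- The bifurcation theorem for a kernel which is everywhere bounded and measurable. -/
theorem exists_branch_of_measurable [TopologicalSpace.SeparableSpace (Lp ℝ 2 vol)]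
    (hUm : Measurable fun p : M × M => U p.1 p.2) (hC : 0 ≤ C) (hUC : ∀ m m', |U m m'| ≤ C)
    (hsymm : ∀ᵐ p : M × M ∂(vol.prod vol), U p.1 p.2 = U p.2 p.1)
    {c : ℝ} (hconst : ∀ᵐ m ∂vol, ∫ m', U m m' ∂vol = c)
    {b : ℝ} (hb : 0 < b) {u : Lp ℝ 2 vol} (hu : u ≠ 0)
    (hker : linearisedSolutions vol U b = (Submodule.span ℝ {u} : Set (Lp ℝ 2 vol))) :
    ∃ ε : ℝ, 0 < ε ∧
      ∃ (β : ℝ → ℝ) (ν ρ : ℝ → Lp ℝ 2 vol),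
        ContinuousOn (fun s => (β s, ν s)) (Set.Ioo (-ε) ε) ∧
        ContinuousOn ρ (Set.Ioo (-ε) ε) ∧
        β 0 = b ∧ ν 0 = isotropicState vol ∧ ρ 0 = 0 ∧
        ∀ s ∈ Set.Ioo (-ε) ε,
          IsSolution vol U (β s) (ν s) ∧
          (s ≠ 0 → ¬ IsIsotropic vol (ν s)) ∧
          ν s = isotropicState vol + s • (u + ρ s) ∧
          inner ℝ u (ρ s) = 0 := by
  have hV : totalVolume vol ≠ 0 := (totalVolume_pos vol).ne'
  set k := kernelCLM vol hUm hC hUC with hk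
  have hmem := fun x => mem_linearisedSolutions_iff vol hUm hC hUC hsymm hconst b x
  have hku : u = b • k u := (hmem u).1 (by rw [hker]; exact Submodule.mem_span_singleton_self u)
  -- Self-adjointness makes the range of `1 - b • k` orthogonal to its kernel.
  have hrange : ∀ x, inner ℝ u (x - b • k x) = 0 := fun x => by
    rw [inner_sub_right, inner_smul_right, kernelCLM_symm vol hUm hC hUC hsymm hconst, ← hk]
    nth_rewrite 1 [hku]
    rw [inner_smul_left]
    simp
  -- Since `k 1 = 0`, the constant `1` lies in the range of `1 - b • k`.
  have hone : inner ℝ u (BoundedMeasurable.toL2 vol 1) = 0 := by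
    have := hrange (BoundedMeasurable.toL2 vol 1)
    rwa [hk, kernelCLM_one vol hUm hC hUC hV hsymm hconst, smul_zero, sub_zero] at this
  obtain ⟨β, ρ, hβ0, hρ0, hβc, hρc, hρu, heq⟩ := exists_bifurcation_branch
    (BoundedMeasurable.toL2 vol) (potentialCLM vol hUm hC hUC) (BoundedMeasurable.integralCLM vol)
    hV k (kernelCLM_apply vol hUm hC hUC) hu hku (isCompactOperator_toL2_comp vol)
    (fun x hx => by
      have h1 : x ∈ (Submodule.span ℝ {u} : Set (Lp ℝ 2 vol)) := hker ▸ (hmem x).2 hx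
      obtain ⟨a, ha⟩ := Submodule.mem_span_singleton.1 h1
      exact ⟨a, ha.symm⟩) hrange
  have hβpos : ∀ᶠ s in 𝓝 (0 : ℝ), 0 < β s :=
    hβc.self_of_nhds.eventually (lt_mem_nhds (hβ0 ▸ hb))
  obtain ⟨ε, hε, hball⟩ := Metric.eventually_nhds_iff_ball.1
    (hβc.and (hρc.and (heq.and hβpos)))
  have hIoo : ∀ s ∈ Set.Ioo (-ε) ε, s ∈ Metric.ball (0 : ℝ) ε := fun s hs => by
    rw [mem_ball_zero_iff, Real.norm_eq_abs, abs_lt]; exact hs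
  refine ⟨ε, hε, β, fun s => isotropicState vol + s • (u + ρ s), ρ, fun s hs => ?_,
    fun s hs => (hball s (hIoo s hs)).2.1.continuousWithinAt, hβ0, by simp, hρ0, fun s hs => ?_⟩
  · obtain ⟨h1, h2, -⟩ := hball s (hIoo s hs)
    refine ContinuousAt.continuousWithinAt ?_
    fun_prop
  · obtain ⟨-, -, h3, h4⟩ := hball s (hIoo s hs)
    refine ⟨⟨h4, Phi_ae_eq_zero vol hUm hC hUC hconst rfl h3⟩, ?_, rfl, hρu s⟩
    rintro hs0 ⟨a, ha⟩
    have hconst' : isotropicState vol + s • (u + ρ s) = a • BoundedMeasurable.toL2 vol 1 := by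
      refine Lp.ext (ha.trans ?_)
      filter_upwards [Lp.coeFn_smul a (BoundedMeasurable.toL2 vol (1 : BoundedMeasurable M)),
        BoundedMeasurable.coeFn_toL2 vol (1 : BoundedMeasurable M)] with m h5 h6
      rw [h5, Pi.smul_apply, h6]; simp
    -- Pairing a supposedly constant state with `u` leaves `s ‖u‖² = 0`.
    have h7 := congrArg (fun x => inner ℝ u x) hconst'
    simp only [isotropicState_eq, inner_add_right, inner_smul_right, hone, hρu s,
      real_inner_self_eq_norm_sq, mul_zero, zero_add, add_zero] at h7
    simp [hs0, hu] at h7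

end Equation

/-! ### Independence of the representative of `U` -/

section Congruence

variable {vol : Measure M} {U U' : M → M → ℝ}

theorem effectivePotential_congr (h : ∀ᵐ m ∂vol, ∀ᵐ m' ∂vol, U m m' = U' m m') (ν : M → ℝ) :
    effectivePotential vol U ν =ᵐ[vol] effectivePotential vol U' ν := by
  filter_upwards [h] with m hm
  exact integral_congr_ae (hm.mono fun m' h' => by simp only [h'])

theorem Phi_congr (h : ∀ᵐ m ∂vol, ∀ᵐ m' ∂vol, U m m' = U' m m') (β : ℝ) (ν : M → ℝ) :
    Phi vol U β ν =ᵐ[vol] Phi vol U' β ν := by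
  have h1 := effectivePotential_congr h ν
  have h2 : partitionFunction vol U β ν = partitionFunction vol U' β ν :=
    integral_congr_ae (h1.mono fun m hm => by simp only [hm])
  filter_upwards [h1] with m hm
  rw [Phi, Phi, h2, hm]

theorem K_congr (h : ∀ᵐ m ∂vol, ∀ᵐ m' ∂vol, U m m' = U' m m') (μ : M → ℝ) :
    K vol U μ =ᵐ[vol] K vol U' μ := by
  filter_upwards [h] with m hm
  have h1 : ∫ m', U m m' ∂vol = ∫ m', U' m m' ∂vol := integral_congr_ae hm
  rw [K, K]
  congr 1
  exact integral_congr_ae (hm.mono fun m' h' => by simp only [centredPotential, h1, h'])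

theorem linearisedSolutions_congr (h : ∀ᵐ m ∂vol, ∀ᵐ m' ∂vol, U m m' = U' m m') (b : ℝ) :
    linearisedSolutions vol U b = linearisedSolutions vol U' b := by
  ext x
  have h1 : (fun m => b * K vol U x m) =ᵐ[vol] fun m => b * K vol U' x m :=
    (K_congr h x).mono fun m hm => by simp only [hm]
  exact ⟨fun hx => EventuallyEq.trans (show x =ᵐ[vol] _ from hx) h1,
    fun hx => EventuallyEq.trans (show x =ᵐ[vol] _ from hx) h1.symm⟩

/-- An essentially bounded function agrees almost everywhere with a bounded measurable one. -/
theorem exists_bounded_measurable_ae_eq {α : Type*} [MeasurableSpace α] {μ : Measure α}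
    {f : α → ℝ} (hf : MemLp f ∞ μ) :
    ∃ (g : α → ℝ) (C : ℝ), Measurable g ∧ 0 ≤ C ∧ (∀ x, |g x| ≤ C) ∧ f =ᵐ[μ] g := by
  set C := (eLpNormEssSup f μ).toReal
  have hC : 0 ≤ C := ENNReal.toReal_nonneg
  have hm := hf.1.aemeasurable
  -- Truncating a measurable representative at the essential supremum gives a bound at every point.
  refine ⟨fun x => max (-C) (min C (hm.mk f x)), C,
    measurable_const.max (measurable_const.min hm.measurable_mk), hC, fun x => ?_, ?_⟩
  · exact abs_le.2 ⟨le_max_left _ _, max_le (by linarith) (min_le_left _ _)⟩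
  · have hb : ∀ᵐ x ∂μ, |f x| ≤ C := by
      filter_upwards [ae_le_eLpNormEssSup (f := f) (μ := μ)] with x hx
      have := ENNReal.toReal_mono (by simpa using hf.2.ne) hx
      simpa using this
    filter_upwards [hb, hm.ae_eq_mk] with x h1 h2
    rw [← h2, min_eq_right (abs_le.1 h1).2, max_eq_right (abs_le.1 h1).1]

end Congruence

end MeanField

end

/-! ### The theorem on the manifold -/

theorem theorem2p6
    {E : Type*} [NormedAddCommGroup E] [NormedSpace ℝ E] [FiniteDimensional ℝ E]
    {H : Type*} [TopologicalSpace H] (I : ModelWithCorners ℝ E H)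
    {M : Type*} [TopologicalSpace M] [ChartedSpace H M] [IsManifold I ∞ M]
    [T2Space M] [CompactSpace M] [ConnectedSpace M]
    [MeasurableSpace M] [BorelSpace M]
    (vol : MeasureTheory.Measure M) [MeasureTheory.IsFiniteMeasure vol] [NeZero vol]
    (U : M → M → ℝ)
    (hU : MeasureTheory.MemLp (fun p : M × M => U p.1 p.2) ∞ (vol.prod vol))
    (hsymm : ∀ᵐ p : M × M ∂(vol.prod vol), U p.1 p.2 = U p.2 p.1)
    (hconst : ∃ c : ℝ, ∀ᵐ m ∂vol, ∫ m', U m m' ∂vol = c)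
    (βstar : ℝ) (hβstar : 0 < βstar)
    (μstar : MeasureTheory.Lp ℝ 2 vol) (hμstar : μstar ≠ 0)
    (hker : MeanField.linearisedSolutions vol U βstar =
      (Submodule.span ℝ {μstar} : Set (MeasureTheory.Lp ℝ 2 vol))) :
    ∃ ε : ℝ, 0 < ε ∧
      ∃ (β : ℝ → ℝ) (ν ρ : ℝ → MeasureTheory.Lp ℝ 2 vol),
        ContinuousOn (fun s => (β s, ν s)) (Set.Ioo (-ε) ε) ∧
        ContinuousOn ρ (Set.Ioo (-ε) ε) ∧
        β 0 = βstar ∧ ν 0 = MeanField.isotropicState vol ∧ ρ 0 = 0 ∧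
        ∀ s ∈ Set.Ioo (-ε) ε,
          MeanField.IsSolution vol U (β s) (ν s) ∧
          (s ≠ 0 → ¬ MeanField.IsIsotropic vol (ν s)) ∧
          ν s = MeanField.isotropicState vol + s • (μstar + ρ s) ∧
          inner ℝ μstar (ρ s) = 0 := by
  -- The manifold structure and compactness are used to make `M` second countable, hence `L²(M)`
  -- separable.
  have : SecondCountableTopology H := I.secondCountableTopology
  have : SecondCountableTopology M := ChartedSpace.secondCountable_of_sigmaCompact H M
  have : Fact ((2 : ℝ≥0∞) ≠ ⊤) := ⟨ENNReal.ofNat_ne_top⟩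
  have : SecondCountableTopology (Lp ℝ 2 vol) := inferInstance
  obtain ⟨c, hconst⟩ := hconst
  obtain ⟨g, C, hgm, hC, hgC, hUg⟩ := MeanField.exists_bounded_measurable_ae_eq hU
  let U' : M → M → ℝ := fun m m' => g (m, m')
  have hUU' : ∀ᵐ m ∂vol, ∀ᵐ m' ∂vol, U m m' = U' m m' := Measure.ae_ae_of_ae_prod hUg
  have hsymm' : ∀ᵐ p : M × M ∂(vol.prod vol), U' p.1 p.2 = U' p.2 p.1 := by
    have hswap : ∀ᵐ p : M × M ∂(vol.prod vol), U p.2 p.1 = g (p.2, p.1) :=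
      (Measure.measurePreserving_swap (μ := vol) (ν := vol)).quasiMeasurePreserving.ae hUg
    filter_upwards [hsymm, hUg, hswap] with p h1 h2 h3
    exact h2.symm.trans (h1.trans h3)
  have hconst' : ∀ᵐ m ∂vol, ∫ m', U' m m' ∂vol = c := by
    filter_upwards [hconst, hUU'] with m h1 h2
    rw [← h1, integral_congr_ae h2]
  rw [MeanField.linearisedSolutions_congr hUU'] at hker
  obtain ⟨ε, hε, β, ν, ρ, hc, hρc, hβ0, hν0, hρ0, h⟩ :=
    MeanField.exists_branch_of_measurable vol (U := U') hgm hC (fun m m' => hgC (m, m')) hsymm'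
      hconst' hβstar hμstar hker
  refine ⟨ε, hε, β, ν, ρ, hc, hρc, hβ0, hν0, hρ0, fun s hs => ?_⟩
  obtain ⟨⟨h1, h2⟩, h3⟩ := h s hs
  exact ⟨⟨h1, (MeanField.Phi_congr hUU' _ _).trans h2⟩, h3⟩
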